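/- For an integer $m\ge 2$, the $m$-bipartite Ramsey number $BR_m(K_{2,2},K_{4,4})$ is the least positive integer $n$ such that for every subgraph $G$ of the complete bipartite graph $K_{m,n}$, either $G$ contains a (not necessarily induced) copy of $K_{2,2}$, or the complement $\overline{G}$ of $G$ in $K_{m,n}$ contains a copy of $K_{4,4}$ (equivalently, every red/blue colouring of the edges of $K_{m,n}$ has a red $K_{2,2}$ or a blue $K_{4,4}$); it does not exist if there is no such $n$. Then \[ BR_m(K_{2,2},K_{4,4})=\begin{cases} \text{does not exist}, & m=2,3,4,\\ 26, & m=5,\\ 22, & m=6,7,\\ 16, & m=8,\\ 14, & 9\le m\le 13. \end{cases} \] -/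

import Mathlib

/-- `BipartiteArrows m n H₁ H₂`: for every subgraph `G` of `K_{m,n}` (the red edges of a red/blue
colouring of the edges of `K_{m,n}`), either `G` contains a copy of `H₁`, or the complement of `G`
inside `K_{m,n}` (the blue edges) contains a copy of `H₂`. Copies are not necessarily induced. -/
def BipartiteArrows {α β : Type*} (m n : ℕ) (H₁ : SimpleGraph α) (H₂ : SimpleGraph β) : Prop :=
  ∀ G : SimpleGraph (Fin m ⊕ Fin n), G ≤ completeBipartiteGraph (Fin m) (Fin n) →
    H₁.IsContained G ∨ H₂.IsContained (completeBipartiteGraph (Fin m) (Fin n) \ G)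

/-- `IsBipartiteRamsey m H₁ H₂ n`: the `m`-bipartite Ramsey number `BR_m(H₁, H₂)` exists and
equals `n`, that is, `n` is the least positive integer such that every red/blue colouring of
`K_{m,n}` has a red `H₁` or a blue `H₂`. -/
def IsBipartiteRamsey {α β : Type*} (m : ℕ) (H₁ : SimpleGraph α) (H₂ : SimpleGraph β)
    (n : ℕ) : Prop :=
  IsLeast {k : ℕ | 1 ≤ k ∧ BipartiteArrows m k H₁ H₂} n

/-- The complete bipartite graph `K_{t,t}`. -/
abbrev Ktt (t : ℕ) : SimpleGraph (Fin t ⊕ Fin t) := completeBipartiteGraph (Fin t) (Fin t)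

open Finset

/-! A colouring is an `m × n` Boolean matrix in which two rows share at most one red column and four
rows share at most three blue ones (`IsAvoiding`). Monotonicity in both sizes leaves one upper bound
and one colouring for each case.

The colourings are explicit. For `m ≤ 4` one red row works for every `n`. For thirteen rows the
plane of order three works, since four lines cover at least `16 - 6 = 10` of its 13 points.

If column `j` has `c j` red entries, then `∑ (c j).choose 2 ≤ m.choose 2` and `∑ (m - c j).choose 4
≤ 3 * m.choose 4`. A suitable combination of the two settles `m = 5` and `m = 6`. For `m = 8` and `m
= 9`, `card_blue_lt` bounds the common blue columns of three, two and one rows, hence the red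
degrees from below, while `2c ≤ c.choose 2 + 3` bounds the number of red edges from above. For `m =
8` the two bounds clash once rows of degree 4 are seen to be disjoint. For `m = 9` they leave
finitely many cases, which a verified search over matrices in canonical form refutes. -/

/-! ### From subgraphs to Boolean matrices -/

theorem exists_embeddings_of_isContained {t m n : ℕ} (ht : 0 < t)
    {G : SimpleGraph (Fin m ⊕ Fin n)} (hG : G ≤ completeBipartiteGraph (Fin m) (Fin n))
    (h : (Ktt t).IsContained G) :
    ∃ f : Fin t ↪ Fin m, ∃ g : Fin t ↪ Fin n, ∀ a b, G.Adj (Sum.inl (f a)) (Sum.inr (g b)) := by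
  obtain ⟨φ⟩ := h
  have hadj : ∀ a b, G.Adj (φ (Sum.inl a)) (φ (Sum.inr b)) := fun a b =>
    φ.toHom.map_adj (by simp [Ktt])
  have hside : ∀ a b, (φ (Sum.inl a)).isLeft = (φ (Sum.inr b)).isRight := by
    intro a b
    have := hG (hadj a b)
    simp only [completeBipartiteGraph_adj] at this
    rcases hx : φ (Sum.inl a) with x | x <;> rcases hy : φ (Sum.inr b) with y | y <;>
      simp [hx, hy] at this ⊢
  have hinj : Function.Injective φ := φ.injective
  rcases h0 : φ (Sum.inl ⟨0, ht⟩) with x0 | x0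
  · have hr : ∀ b, ∃ y, φ (Sum.inr b) = Sum.inr y := fun b =>
      Sum.isRight_iff.1 (by rw [← hside ⟨0, ht⟩ b, h0]; rfl)
    have hl : ∀ a, ∃ y, φ (Sum.inl a) = Sum.inl y := fun a =>
      Sum.isLeft_iff.1 (by obtain ⟨y, hy⟩ := hr ⟨0, ht⟩; rw [hside a ⟨0, ht⟩, hy]; rfl)
    choose g hg using hr
    choose f hf using hl
    refine ⟨⟨f, fun a a' haa => ?_⟩, ⟨g, fun b b' hbb => ?_⟩, fun a b => ?_⟩
    · have : φ (Sum.inl a) = φ (Sum.inl a') := by rw [hf, hf, haa]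
      exact Sum.inl_injective (hinj this)
    · have : φ (Sum.inr b) = φ (Sum.inr b') := by rw [hg, hg, hbb]
      exact Sum.inr_injective (hinj this)
    · have := hadj a b
      rwa [hf, hg] at this
  -- The copy may lie with its sides exchanged; the symmetry of `Ktt t` then lets `f` and `g` trade
  -- roles.
  · have hr : ∀ b, ∃ y, φ (Sum.inr b) = Sum.inl y := fun b =>
      Sum.isLeft_iff.1 (by
        have := hside ⟨0, ht⟩ b
        rw [h0] at this
        cases h : φ (Sum.inr b) <;> simp [h] at this ⊢)
    have hl : ∀ a, ∃ y, φ (Sum.inl a) = Sum.inr y := fun a =>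
      Sum.isRight_iff.1 (by
        obtain ⟨y, hy⟩ := hr ⟨0, ht⟩
        have := hside a ⟨0, ht⟩
        rw [hy] at this
        cases h : φ (Sum.inl a) <;> simp [h] at this ⊢)
    choose f hf using hr
    choose g hg using hl
    refine ⟨⟨f, fun a a' haa => ?_⟩, ⟨g, fun b b' hbb => ?_⟩, fun a b => ?_⟩
    · have : φ (Sum.inr a) = φ (Sum.inr a') := by rw [hf, hf, haa]
      exact Sum.inr_injective (hinj this)
    · have : φ (Sum.inl b) = φ (Sum.inl b') := by rw [hg, hg, hbb]
      exact Sum.inl_injective (hinj this)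
    · have := (hadj b a).symm
      rwa [hf, hg] at this

theorem isContained_of_embeddings {t m n : ℕ} {G : SimpleGraph (Fin m ⊕ Fin n)}
    (f : Fin t ↪ Fin m) (g : Fin t ↪ Fin n)
    (h : ∀ a b, G.Adj (Sum.inl (f a)) (Sum.inr (g b))) : (Ktt t).IsContained G := by
  refine ⟨⟨⟨Sum.map f g, ?_⟩, Sum.map_injective.2 ⟨f.injective, g.injective⟩⟩⟩
  rintro (a | a) (b | b) hab
  · simp [Ktt] at hab
  · exact h a b
  · exact (h b a).symm
  · simp [Ktt] at hab

theorem exists_embeddings_iff {m n s t : ℕ} (p : Fin m → Fin n → Prop)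
    [∀ i j, Decidable (p i j)] :
    (∃ f : Fin s ↪ Fin m, ∃ g : Fin t ↪ Fin n, ∀ a b, p (f a) (g b)) ↔
      ∃ S : Finset (Fin m), #S = s ∧ t ≤ #{j | ∀ i ∈ S, p i j} := by
  constructor
  · rintro ⟨f, g, h⟩
    refine ⟨univ.map f, by simp, ?_⟩
    calc t = #(univ.map g) := by simp
      _ ≤ _ := card_le_card fun j hj => by
        obtain ⟨b, -, rfl⟩ := mem_map.1 hj
        simpa using fun a => h a b
  · rintro ⟨S, hS, ht⟩
    obtain ⟨T, hT, hTc⟩ := exists_subset_card_eq ht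
    refine ⟨(S.orderEmbOfFin hS).toEmbedding, (T.orderEmbOfFin hTc).toEmbedding, fun a b => ?_⟩
    exact (mem_filter.1 (hT (T.orderEmbOfFin_mem hTc b))).2 _ (S.orderEmbOfFin_mem hS a)

/-- A red/blue colouring of `K_{m,n}` (with `true` for red) without a red `K_{2,2}` and without a
blue `K_{4,4}`. -/
structure IsAvoiding {m n : ℕ} (R : Fin m → Fin n → Bool) : Prop where
  red : ∀ S : Finset (Fin m), #S = 2 → #{j | ∀ i ∈ S, R i j = true} ≤ 1
  blue : ∀ S : Finset (Fin m), #S = 4 → #{j | ∀ i ∈ S, R i j = false} ≤ 3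

theorem bipartiteArrows_iff {m n : ℕ} :
    BipartiteArrows m n (Ktt 2) (Ktt 4) ↔ ∀ R : Fin m → Fin n → Bool, ¬ IsAvoiding R := by
  have key : ∀ R : Fin m → Fin n → Bool, ¬ IsAvoiding R ↔
      (∃ f : Fin 2 ↪ Fin m, ∃ g : Fin 2 ↪ Fin n, ∀ a b, R (f a) (g b) = true) ∨
      (∃ f : Fin 4 ↪ Fin m, ∃ g : Fin 4 ↪ Fin n, ∀ a b, R (f a) (g b) = false) := by
    intro R
    rw [exists_embeddings_iff (fun i j => R i j = true),
      exists_embeddings_iff (fun i j => R i j = false)]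
    constructor
    · intro h
      by_contra! hc
      exact h ⟨fun S hS => Nat.lt_succ_iff.1 (hc.1 S hS), fun S hS => Nat.lt_succ_iff.1 (hc.2 S hS)⟩
    · rintro (⟨S, hS, h⟩ | ⟨S, hS, h⟩) hR
      · have := hR.red S hS
        omega
      · have := hR.blue S hS
        omega
  simp_rw [key]
  constructor
  · intro h R
    let G : SimpleGraph (Fin m ⊕ Fin n) :=
      SimpleGraph.fromRel fun u v => ∃ i j, u = Sum.inl i ∧ v = Sum.inr j ∧ R i j = true
    have hadj : ∀ i j, G.Adj (Sum.inl i) (Sum.inr j) ↔ R i j = true := by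
      intro i j
      simp [G]
    have hG : G ≤ completeBipartiteGraph (Fin m) (Fin n) := by
      rintro (i | i) (j | j) hij <;> simp [G] at hij ⊢
    rcases h G hG with h | h
    · obtain ⟨f, g, hfg⟩ := exists_embeddings_of_isContained two_pos hG h
      exact Or.inl ⟨f, g, fun a b => (hadj _ _).1 (hfg a b)⟩
    · obtain ⟨f, g, hfg⟩ := exists_embeddings_of_isContained four_pos sdiff_le h
      refine Or.inr ⟨f, g, fun a b => ?_⟩
      have := (hfg a b).2
      rw [hadj] at this
      simpa using this
  · intro h G hG
    classical
    rcases h fun i j => decide (G.Adj (Sum.inl i) (Sum.inr j)) with ⟨f, g, hfg⟩ | ⟨f, g, hfg⟩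
    · exact Or.inl (isContained_of_embeddings f g fun a b => by simpa using hfg a b)
    · exact Or.inr (isContained_of_embeddings f g fun a b => by
        simpa [SimpleGraph.sdiff_adj] using hfg a b)

theorem BipartiteArrows.mono {m n m' n' : ℕ} (h : BipartiteArrows m n (Ktt 2) (Ktt 4))
    (hm : m ≤ m') (hn : n ≤ n') : BipartiteArrows m' n' (Ktt 2) (Ktt 4) := by
  rw [bipartiteArrows_iff] at h ⊢
  intro R hR
  refine h (fun i j => R (i.castLE hm) (j.castLE hn)) ⟨fun S hS => ?_, fun S hS => ?_⟩
  · refine le_trans ?_ (hR.red (S.map (Fin.castLEEmb hm)) (by simpa using hS))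
    refine card_le_card_of_injOn (Fin.castLE hn) (fun j hj => ?_) ((Fin.castLE_injective hn).injOn)
    simpa using hj
  · refine le_trans ?_ (hR.blue (S.map (Fin.castLEEmb hm)) (by simpa using hS))
    refine card_le_card_of_injOn (Fin.castLE hn) (fun j hj => ?_) ((Fin.castLE_injective hn).injOn)
    simpa using hj

/-- An upper bound at `m` and a colouring with `l` rows settle every `m'` between `m` and `l`. -/
theorem isBipartiteRamsey_of_avoiding {m m' n : ℕ} (h : BipartiteArrows m (n + 1) (Ktt 2) (Ktt 4))
    (hmm : m ≤ m') {l : ℕ} {R : Fin l → Fin n → Bool} (hR : IsAvoiding R) (hl : m' ≤ l) :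
    IsBipartiteRamsey m' (Ktt 2) (Ktt 4) (n + 1) := by
  refine ⟨⟨by omega, h.mono hmm le_rfl⟩, fun k hk => ?_⟩
  by_contra! hlt
  exact bipartiteArrows_iff.1 (hk.2.mono hl (by omega : k ≤ n)) R hR

/-! Colourings -/

theorem isAvoiding_of_forall_lt {m n : ℕ} {R : Fin m → Fin n → Bool}
    (h₂ : ∀ i j, i < j → #{c | R i c = true ∧ R j c = true} ≤ 1)
    (h₄ : ∀ i j, i < j → ∀ k, j < k → ∀ l, k < l →
      #{c | R i c = false ∧ R j c = false ∧ R k c = false ∧ R l c = false} ≤ 3) :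
    IsAvoiding R := by
  refine ⟨fun S hS => ?_, fun S hS => ?_⟩
  · let e := S.orderEmbOfFin hS
    have he : ∀ a, e a ∈ S := S.orderEmbOfFin_mem hS
    refine le_trans (card_le_card fun c hc => ?_) (h₂ (e 0) (e 1) (e.strictMono (by decide)))
    simp only [mem_filter, mem_univ, true_and] at hc ⊢
    exact ⟨hc _ (he 0), hc _ (he 1)⟩
  · let e := S.orderEmbOfFin hS
    have he : ∀ a, e a ∈ S := S.orderEmbOfFin_mem hS
    refine le_trans (card_le_card fun c hc => ?_) (h₄ (e 0) (e 1) (e.strictMono (by decide))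
      (e 2) (e.strictMono (by decide)) (e 3) (e.strictMono (by decide)))
    simp only [mem_filter, mem_univ, true_and] at hc ⊢
    exact ⟨hc _ (he 0), hc _ (he 1), hc _ (he 2), hc _ (he 3)⟩

/-- Two distinct rows are never both red, and four distinct rows among at most four include the red
row. -/
theorem isAvoiding_row (m n : ℕ) (hm : m ≤ 4) :
    IsAvoiding (fun (i : Fin m) (_ : Fin n) => decide (i.val = 0)) := by
  refine isAvoiding_of_forall_lt (fun i j hij => ?_) fun i j hij k hjk l hkl => ?_
  · have : j.val ≠ 0 := by omega
    simp [this]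
  · have : i.val = 0 := by omega
    simp [this]

/-- The colouring of `K_{m,n}` whose red rows are given by the binary digits of `v`. -/
def colouringOfMasks {m : ℕ} (n : ℕ) (v : Fin m → ℕ) (i : Fin m) (j : Fin n) : Bool :=
  (v i).testBit j

/-- Ten columns are the pairs of rows; the other fifteen have one red entry, three of them for each
row. -/
theorem isAvoiding_five : IsAvoiding (colouringOfMasks 25
    ![492577, 3704898, 13176964, 22159624, 27542032]) :=
  isAvoiding_of_forall_lt (by decide +kernel) (by decide +kernel)

/-- The columns are the 21 pairs of rows, so four rows are all blue exactly at the three pairs among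
the other three rows. -/
theorem isAvoiding_seven : IsAvoiding (colouringOfMasks 21
    ![63, 1985, 30786, 231556, 823560, 1384976, 1721376]) :=
  isAvoiding_of_forall_lt (by decide +kernel) (by decide +kernel)

theorem isAvoiding_eight : IsAvoiding (colouringOfMasks 15
    ![31, 225, 802, 3396, 12872, 17416, 6192, 24976]) :=
  isAvoiding_of_forall_lt (by decide +kernel) (by decide +kernel)

/-- The red edges are the incidences of the projective plane of order three. -/
theorem isAvoiding_thirteen : IsAvoiding fun i j : Fin 13 => decide (i + j ∈ [0, 1, 3, 9]) :=
  isAvoiding_of_forall_lt (by decide +kernel) (by decide +kernel)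

/-! ### Double counting and convexity -/

theorem sum_card_inter_choose {ι κ : Type*} [DecidableEq ι] (W : Finset κ) (T : Finset ι)
    (A : κ → Finset ι) (k : ℕ) :
    ∑ j ∈ W, (#(A j ∩ T)).choose k = ∑ S ∈ T.powersetCard k, #{j ∈ W | S ⊆ A j} := by
  have := sum_card_bipartiteAbove_eq_sum_card_bipartiteBelow (s := W) (t := T.powersetCard k)
    (fun j S => S ⊆ A j)
  simp only [bipartiteAbove, bipartiteBelow] at this
  rw [← this]
  refine sum_congr rfl fun j _ => ?_
  rw [← card_powersetCard]
  congr 1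
  ext S
  simp only [mem_powersetCard, subset_inter_iff, mem_filter]
  tauto

/-- The difference of the two sides is `(c - 2)(c - 3) / 2`, which is nonnegative at integers. -/
theorem two_mul_le_choose_two_add (c : ℕ) : 2 * c ≤ c.choose 2 + 3 := by
  induction c with
  | zero => omega
  | succ c ih =>
    rw [Nat.choose_succ_succ' c 1, Nat.choose_one_right]
    rcases Nat.lt_or_ge c 2 with h | h
    · interval_cases c <;> simp
    · simp only [Nat.reduceAdd]
      omega

section

variable {m n : ℕ} {R : Fin m → Fin n → Bool}

/-- The rows joined to the column `j` by a red edge. -/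
def redRows (R : Fin m → Fin n → Bool) (j : Fin n) : Finset (Fin m) := {i | R i j = true}

@[simp]
theorem mem_redRows {i : Fin m} {j : Fin n} : i ∈ redRows R j ↔ R i j = true := by
  simp [redRows]

theorem IsAvoiding.card_le_one (hR : IsAvoiding R) (W : Finset (Fin n)) {S : Finset (Fin m)}
    (hS : #S = 2) : #{j ∈ W | S ⊆ redRows R j} ≤ 1 :=
  le_trans (card_le_card fun j hj => by
    simp only [mem_filter, mem_univ, true_and] at hj ⊢
    exact fun i hi => by simpa using hj.2 hi) (hR.red S hS)

theorem IsAvoiding.sum_choose_two_le (hR : IsAvoiding R) (W : Finset (Fin n))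
    (T : Finset (Fin m)) :
    ∑ j ∈ W, (#(redRows R j ∩ T)).choose 2 ≤ (#T).choose 2 := by
  rw [sum_card_inter_choose W T (fun j => redRows R j) 2,
    ← card_powersetCard, card_eq_sum_ones]
  exact sum_le_sum fun S hS => hR.card_le_one W (mem_powersetCard.1 hS).2

theorem IsAvoiding.sum_choose_four_le (hR : IsAvoiding R) :
    ∑ j, (m - #(redRows R j)).choose 4 ≤ 3 * m.choose 4 := by
  have h : ∀ j, (m - #(redRows R j)) = #(({i | R i j = false} : Finset (Fin m)) ∩ univ) := by
    intro j
    have := card_filter_add_card_filter_not (s := (univ : Finset (Fin m)))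
      (fun i => R i j = true)
    simp only [card_univ, Fintype.card_fin, Bool.not_eq_true] at this
    rw [inter_univ, redRows]
    omega
  simp_rw [h]
  rw [sum_card_inter_choose univ univ (fun j => ({i | R i j = false} : Finset (Fin m))) 4]
  calc _ ≤ ∑ S ∈ (univ : Finset (Fin m)).powersetCard 4, 3 := by
        refine sum_le_sum fun S hS => le_trans (card_le_card fun j hj => ?_)
          (hR.blue S (mem_powersetCard.1 hS).2)
        simp only [mem_filter, mem_univ, true_and] at hj ⊢
        exact fun i hi => by simpa using hj hi
    _ = _ := by simp [card_powersetCard, mul_comm]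

theorem sum_card_red_inter (W : Finset (Fin n)) (T : Finset (Fin m)) :
    ∑ j ∈ W, #(redRows R j ∩ T) = ∑ i ∈ T, #{j ∈ W | R i j = true} := by
  have := sum_card_bipartiteAbove_eq_sum_card_bipartiteBelow (s := T) (t := W)
    (fun i j => R i j = true)
  simp only [bipartiteAbove, bipartiteBelow] at this
  rw [this]
  refine sum_congr rfl fun j _ => ?_
  congr 1
  ext i
  simp [and_comm]

/-- The number of red edges between the rows `T` and the columns `W` is bounded by convexity. -/
theorem IsAvoiding.two_mul_sum_card_le (hR : IsAvoiding R) (W : Finset (Fin n))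
    (T : Finset (Fin m)) :
    2 * ∑ i ∈ T, #{j ∈ W | R i j = true} ≤ (#T).choose 2 + 3 * #W := by
  rw [← sum_card_red_inter, mul_sum]
  calc _ ≤ ∑ j ∈ W, ((#(redRows R j ∩ T)).choose 2 + 3) :=
        sum_le_sum fun j _ => two_mul_le_choose_two_add _
    _ ≤ _ := by
        rw [sum_add_distrib, sum_const, smul_eq_mul, mul_comm _ 3]
        exact Nat.add_le_add_right (hR.sum_choose_two_le W T) _

/-- A bound for the number of common blue columns of `s + 1` rows gives one for `s` rows. -/
theorem IsAvoiding.card_blue_lt (hR : IsAvoiding R) {s b w : ℕ}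
    (h : ∀ S : Finset (Fin m), #S = s + 1 → #{j | ∀ i ∈ S, R i j = false} ≤ b)
    (hw : (m - s).choose 2 + 3 * w < 2 * ((m - s) * (w - b)))
    (S : Finset (Fin m)) (hS : #S = s) : #{j | ∀ i ∈ S, R i j = false} < w := by
  by_contra! hlt
  obtain ⟨W, hW, rfl⟩ := exists_subset_card_eq hlt
  have hT : #Sᶜ = m - s := by simp [card_compl, hS]
  have h1 := hR.two_mul_sum_card_le W Sᶜ
  -- `W` is blue on `S`, so a row outside `S` is blue on at most `b` columns of `W`. This forces
  -- more red entries in `W` than convexity permits.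
  have h2 : #Sᶜ * (#W - b) ≤ ∑ i ∈ Sᶜ, #{j ∈ W | R i j = true} := by
    rw [← smul_eq_mul]
    refine card_nsmul_le_sum _ _ _ fun i hi => ?_
    have hb := h (insert i S) (by rw [card_insert_of_notMem (mem_compl.1 hi), hS])
    have hle : #{j ∈ W | ¬ R i j = true} ≤ b := by
      refine le_trans (card_le_card fun j hj => ?_) hb
      simp only [mem_filter, mem_univ, true_and, mem_insert] at hj ⊢
      have := (mem_filter.1 (hW hj.1)).2
      rintro k (rfl | hk)
      · simpa using hj.2
      · exact this k hk
    have := card_filter_add_card_filter_not (s := W) (fun j => R i j = true)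
    omega
  rw [hT] at h1 h2
  omega

/-- The number of red edges at a row. -/
def rowDegree (R : Fin m → Fin n → Bool) (i : Fin m) : ℕ := #{j | R i j = true}

theorem rowDegree_add_card_blue (i : Fin m) :
    rowDegree R i + #{j | ∀ k ∈ ({i} : Finset (Fin m)), R k j = false} = n := by
  have := card_filter_add_card_filter_not (s := (univ : Finset (Fin n))) (fun j => R i j = true)
  simpa [rowDegree] using this

theorem IsAvoiding.two_mul_sum_rowDegree_le (hR : IsAvoiding R) :
    2 * ∑ i, rowDegree R i ≤ m.choose 2 + 3 * n := by
  simpa [rowDegree] using hR.two_mul_sum_card_le univ univ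

end

/-! ### Upper bounds for five, six and eight rows -/

theorem arrows_five : BipartiteArrows 5 26 (Ktt 2) (Ktt 4) := by
  rw [bipartiteArrows_iff]
  intro R hR
  have h2 := hR.sum_choose_two_le univ univ
  have h4 := hR.sum_choose_four_le
  simp only [inter_univ] at h2
  -- Equality holds for one or two red entries. The sum over all columns is at most `15 + 10 = 25 <
  -- 26`.
  have h : ∀ j : Fin 26, 1 ≤ (5 - #(redRows R j)).choose 4 + (#(redRows R j)).choose 2 := by
    intro j
    have : #(redRows R j) ≤ 5 := by simpa using card_le_univ (redRows R j)
    revert this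
    generalize #(redRows R j) = c
    decide +revert
  have := sum_le_sum fun j (_ : j ∈ univ) => h j
  rw [sum_add_distrib] at this
  simp [Nat.choose] at this h2 h4
  omega

theorem arrows_six : BipartiteArrows 6 22 (Ktt 2) (Ktt 4) := by
  rw [bipartiteArrows_iff]
  intro R hR
  have h2 := hR.sum_choose_two_le univ univ
  have h4 := hR.sum_choose_four_le
  simp only [inter_univ] at h2
  -- The weight 4 gives equality at both one and two red entries. The total is at most `45 + 4 * 15
  -- = 105 < 5 * 22`.
  have h : ∀ j : Fin 22, 5 ≤ (6 - #(redRows R j)).choose 4 + 4 * (#(redRows R j)).choose 2 := by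
    intro j
    have : #(redRows R j) ≤ 6 := by simpa using card_le_univ (redRows R j)
    revert this
    generalize #(redRows R j) = c
    decide +revert
  have := sum_le_sum fun j (_ : j ∈ univ) => h j
  rw [sum_add_distrib, ← mul_sum] at this
  simp [Nat.choose] at this h2 h4
  omega

theorem arrows_eight : BipartiteArrows 8 16 (Ktt 2) (Ktt 4) := by
  rw [bipartiteArrows_iff]
  intro R hR
  -- Three rows share at most 5 blue columns, hence two at most 8, hence one row has at most 12.
  have h3 := hR.card_blue_lt (w := 6) hR.blue (by decide)
  have h2 := hR.card_blue_lt (w := 9) (fun S hS => Nat.lt_succ_iff.1 (h3 S hS)) (by decide)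
  have h1 := hR.card_blue_lt (w := 13) (fun S hS => Nat.lt_succ_iff.1 (h2 S hS)) (by decide)
  have hdeg : ∀ i, 4 ≤ rowDegree R i := fun i => by
    have := h1 {i} rfl
    have := rowDegree_add_card_blue (R := R) i
    omega
  set F : Finset (Fin 8) := {i | rowDegree R i = 4} with hF
  -- Two rows share at most 8 blue columns, so their red columns cover at least `8 = 4 + 4`: two
  -- rows of degree 4 have no common red column.
  have hdisj : ∀ S : Finset (Fin 8), S ⊆ F → #S = 2 → #{j | S ⊆ redRows R j} = 0 := by
    intro S hSF hS
    obtain ⟨x, y, hxy, rfl⟩ := card_eq_two.1 hS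
    have hx : #{j | R x j = true} = 4 := (mem_filter.1 (hSF (mem_insert_self x _))).2
    have hy : #{j | R y j = true} = 4 :=
      (mem_filter.1 (hSF (mem_insert_of_mem (mem_singleton_self y)))).2
    have hu := card_union_add_card_inter ({j | R x j = true} : Finset (Fin 16)) {j | R y j = true}
    have hb := h2 {x, y} hS
    have hc := card_filter_add_card_filter_not (s := (univ : Finset (Fin 16)))
      (fun j => ∀ i ∈ ({x, y} : Finset (Fin 8)), R i j = false)
    have hcu : ({j | ¬ ∀ i ∈ ({x, y} : Finset (Fin 8)), R i j = false} : Finset (Fin 16)) =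
        ({j | R x j = true} : Finset (Fin 16)) ∪ ({j | R y j = true} : Finset (Fin 16)) := by
      ext j
      cases hx : R x j <;> cases hy : R y j <;> simp [hx, hy]
    have hci : ({j | ({x, y} : Finset (Fin 8)) ⊆ redRows R j} : Finset (Fin 16)) =
        ({j | R x j = true} : Finset (Fin 16)) ∩ ({j | R y j = true} : Finset (Fin 16)) := by
      ext j
      simp [insert_subset_iff]
    rw [hcu, card_univ, Fintype.card_fin] at hc
    rw [hci]
    omega
  have hpairs : ∑ j, (#(redRows R j)).choose 2 + (#F).choose 2 ≤ 28 := by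
    have h := sum_card_inter_choose univ univ
      (fun j => redRows R j) 2
    simp only [inter_univ] at h
    rw [h, ← card_powersetCard 2 F,
      ← sum_sdiff (powersetCard_mono (subset_univ F) : powersetCard 2 F ⊆ powersetCard 2 univ),
      sum_eq_zero (s := powersetCard 2 F) fun S hS =>
        hdisj S (mem_powersetCard.1 hS).1 (mem_powersetCard.1 hS).2, add_zero]
    calc _ ≤ #(powersetCard 2 (univ : Finset (Fin 8)) \ powersetCard 2 F) +
          #(powersetCard 2 F) := by
          rw [card_eq_sum_ones (_ \ _)]
          exact Nat.add_le_add_right (sum_le_sum fun S hS =>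
            hR.card_le_one univ (mem_powersetCard.1 (mem_sdiff.1 hS).1).2) _
      _ = #(powersetCard 2 (univ : Finset (Fin 8))) :=
          card_sdiff_add_card_eq_card (powersetCard_mono (subset_univ F))
      _ ≤ 28 := by simp [card_powersetCard, Nat.choose]
  have hsum : 2 * ∑ i, rowDegree R i ≤ ∑ j, (#(redRows R j)).choose 2 + 48 := by
    have h := sum_card_red_inter (R := R) univ univ
    simp only [inter_univ] at h
    simp only [rowDegree]
    rw [← h, mul_sum]
    calc _ ≤ ∑ j : Fin 16, ((#(redRows R j)).choose 2 + 3) :=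
          sum_le_sum fun j _ => two_mul_le_choose_two_add _
      _ = _ := by simp [sum_add_distrib]
  have hlow : 40 ≤ ∑ i, rowDegree R i + #F := by
    rw [hF, card_filter, ← sum_add_distrib]
    calc 40 = ∑ _i : Fin 8, 5 := by simp
      _ ≤ _ := sum_le_sum fun i _ => by
        have := hdeg i
        split_ifs <;> omega
  have hFc : #F ≤ 8 := by simpa using card_le_univ F
  -- With `f = #F` the bounds combine to `2 * (40 - f) ≤ 28 - f.choose 2 + 48`, that is `f.choose 2
  -- + 4 ≤ 2 * f`.
  have hchoose : ∀ f ≤ 8, 2 * f ≤ f.choose 2 + 3 := by decide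
  have := hchoose _ hFc
  omega

/-! ### Exhaustive search

Rows are encoded by the binary number of their blue columns; a coloured `K_{9,14}` is a list of
nine such numbers, sorted by red degree and then by size. -/

/-- Clear the lowest set bit. -/
def strip (x : ℕ) : ℕ := Nat.land x (Nat.sub x 1)

/-- The numbers below `2 ^ n` with exactly `d` zero digits among the last `n`, in increasing
order. -/
def masksOfDegree : ℕ → ℕ → List ℕ
  | 0, 0 => [0]
  | 0, _ + 1 => []
  | n + 1, 0 => [Nat.sub (Nat.pow 2 (n + 1)) 1]
  | n + 1, d + 1 => masksOfDegree n d ++ (masksOfDegree n (d + 1)).map (Nat.add (Nat.pow 2 n))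

/-- The number of zeros among the last `n` binary digits of `b`. -/
def maskDegree (b : ℕ) : ℕ → ℕ
  | 0 => 0
  | n + 1 => bif Nat.testBit b n then maskDegree b n else Nat.succ (maskDegree b n)

/-- Selection by a Boolean, one definitional unfolding away from the recursor. -/
noncomputable def boolRec {α : Type} (a b : α) (c : Bool) : α := Bool.rec a b c

/-- `List.all`, defined by the recursor for fast evaluation in the kernel. -/
noncomputable def kernelAll (p : ℕ → Bool) (l : List ℕ) : Bool :=
  List.rec true (fun a _ ih => boolRec false ih (p a)) l

/-- `List.filter`, defined by the recursor for fast evaluation in the kernel. -/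
noncomputable def kernelFilter (p : ℕ → Bool) (l : List ℕ) : List ℕ :=
  List.rec [] (fun a _ ih => boolRec ih (a :: ih) (p a)) l

/-- Test a property of all decompositions of a list into an element and the tail after it. -/
noncomputable def scan (step : ℕ → List ℕ → Bool) (l : List ℕ) : Bool :=
  List.rec true (fun a r ih => boolRec false ih (step a r)) l

/-- Whether the row `c` may be added after the row `x`, where `T₂` and `T₃` hold the common blue
columns of `x` with one and with two earlier rows. -/
noncomputable def compat (x : ℕ) (T₂ T₃ : List ℕ) (c : ℕ) : Bool :=
  boolRec false
    (boolRec false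
      (kernelAll
        -- Five strips test for at most five common blue columns of three rows, the derived bound;
        -- three strips test the bound for four rows. In the last test, `16383 = 2 ^ 14 - 1` turns
        -- blue masks into common red columns.
        (fun y => Nat.beq (strip (strip (strip (strip (strip (Nat.land y c)))))) 0) T₂)
      (kernelAll (fun y => Nat.beq (strip (strip (strip (Nat.land y c)))) 0) T₃))
    (Nat.beq (strip (Nat.sub 16383 (Nat.lor x c))) 0)

/-- The set bits `j + 1` of `E` mark columns `j`, `j + 1` which agree in all earlier rows; in each
such block the red columns of a row come last in the binary expansion. -/
def columnTest (E b : ℕ) : Bool :=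
  Nat.beq (Nat.land (Nat.land b E) (Nat.shiftLeft b 1)) (Nat.land b E)

/-- Update the marks of `columnTest` by a new row. -/
def columnNext (E b : ℕ) : ℕ := Nat.xor E (Nat.land E (Nat.xor b (Nat.shiftLeft b 1)))

/-- Refute all ways to add `k` rows from `cand` to `rows`, whose pairwise common blue columns are
`pairs` and whose degree sum is `s`. -/
noncomputable def search : ℕ → ℕ → ℕ → List ℕ → List ℕ → List ℕ → Bool
  | 0, _, _, _, _, _ => false
  | Nat.succ k, E, s, rows, pairs, cand =>
    scan (fun x rest => bif columnTest E x then
      -- The remaining `k + 1` rows have degree at least that of `x`, and 39 bounds the total.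
      (bif Nat.ble (Nat.add s (Nat.mul (maskDegree x 14) (k.succ))) 39 then
        (fun T₂ => (fun c₂ => Nat.blt c₂.length k ||
            search k (columnNext E x) (Nat.add s (maskDegree x 14)) (x :: rows) (T₂ ++ pairs) c₂)
          (kernelFilter (compat x T₂ (pairs.map (Nat.land x))) rest)) (rows.map (Nat.land x))
        else true) else true) cand

/-- All rows of degree at least `d`. -/
def candidates (d : ℕ) : List ℕ := (List.range' d (15 - d)).flatMap (masksOfDegree 14)

/-- Refute all colourings of `K_{9,14}` with minimum degree `d`. -/
noncomputable def searchFrom (d : ℕ) : Bool :=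
  -- The bits of `16382 = 2 ^ 14 - 2` are 1 to 13: before the first row all adjacent columns agree.
  kernelAll (fun x => bif columnTest 16382 x then
    search 8 (columnNext 16382 x) d [x] [] (kernelFilter (compat x [] []) (candidates d))
    else true) (masksOfDegree 14 d)

theorem searchFrom_two : searchFrom 2 = true := by
  decide +kernel

theorem searchFrom_three : searchFrom 3 = true := by
  decide +kernel

theorem searchFrom_four : searchFrom 4 = true := by
  decide +kernel

/-! ### Soundness of the search -/

theorem boolRec_eq {α : Type} (a b : α) (c : Bool) : boolRec a b c = bif c then b else a := by
  cases c <;> rfl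

theorem kernelAll_eq (p : ℕ → Bool) (l : List ℕ) : kernelAll p l = l.all p := by
  induction l with
  | nil => rfl
  | cons a l ih =>
    rw [List.all_cons, ← ih]
    change boolRec false (kernelAll p l) (p a) = _
    rw [boolRec_eq]
    cases p a <;> rfl

theorem kernelFilter_eq (p : ℕ → Bool) (l : List ℕ) : kernelFilter p l = l.filter p := by
  induction l with
  | nil => rfl
  | cons a l ih =>
    rw [List.filter_cons, ← ih]
    change boolRec (kernelFilter p l) (a :: kernelFilter p l) (p a) = _
    rw [boolRec_eq]
    cases p a <;> rfl

theorem exists_of_scan {step : ℕ → List ℕ → Bool} {cand l : List ℕ} {x : ℕ}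
    (h : scan step cand = true) (hl : (x :: l).Sublist cand) :
    ∃ rest, l.Sublist rest ∧ step x rest = true := by
  induction cand with
  | nil => simp at hl
  | cons a r ih =>
    have h' : boolRec false (scan step r) (step a r) = true := h
    rw [boolRec_eq] at h'
    cases hs : step a r with
    | false => simp [hs] at h'
    | true =>
      simp only [hs, cond_true] at h'
      rcases List.sublist_cons_iff.1 hl with hl | ⟨r', hr', hl⟩
      · exact ih h' hl
      · obtain ⟨rfl, rfl⟩ := List.cons.inj hr'
        exact ⟨r, hl, hs⟩

theorem compat_eq_true {x c : ℕ} {T₂ T₃ : List ℕ}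
    (h₁ : strip (16383 - (x ||| c)) = 0)
    (h₂ : ∀ y ∈ T₂, strip^[5] (y &&& c) = 0) (h₃ : ∀ y ∈ T₃, strip^[3] (y &&& c) = 0) :
    compat x T₂ T₃ c = true := by
  have e₁ : Nat.beq (strip (Nat.sub 16383 (Nat.lor x c))) 0 = true := by
    rw [Nat.beq_eq]
    exact h₁
  have e₂ : T₂.all
      (fun y => Nat.beq (strip (strip (strip (strip (strip (Nat.land y c)))))) 0) = true :=
    List.all_eq_true.2 fun y hy => by rw [Nat.beq_eq]; exact h₂ y hy
  have e₃ : T₃.all (fun y => Nat.beq (strip (strip (strip (Nat.land y c)))) 0) = true :=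
    List.all_eq_true.2 fun y hy => by rw [Nat.beq_eq]; exact h₃ y hy
  rw [compat, e₁, kernelAll_eq, kernelAll_eq, e₂, e₃]
  rfl

/-- Each row passes `columnTest` for the marks left by its predecessors. -/
def ColumnSorted : ℕ → List ℕ → Prop
  | _, [] => True
  | E, b :: l => columnTest E b = true ∧ ColumnSorted (columnNext E b) l

/-- The conditions on the remaining rows `l` of a colouring that `search` makes use of. -/
structure Admissible (E s : ℕ) (rows pairs l : List ℕ) : Prop where
  columns : ColumnSorted E l
  sum_le : s + (l.map (maskDegree · 14)).sum ≤ 39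
  sorted : l.Pairwise (maskDegree · 14 ≤ maskDegree · 14)
  red : ∀ x c, [x, c].Sublist l → strip (16383 - (x ||| c)) = 0
  rows_blue : ∀ r ∈ rows, ∀ x c, [x, c].Sublist l → strip^[5] ((x &&& r) &&& c) = 0
  pairs_blue : ∀ p ∈ pairs, ∀ x c, [x, c].Sublist l → strip^[3] ((x &&& p) &&& c) = 0
  three_blue : ∀ r x c, [r, x, c].Sublist l → strip^[5] ((x &&& r) &&& c) = 0
  rows_three_blue : ∀ q ∈ rows, ∀ r x c, [r, x, c].Sublist l →
    strip^[3] ((x &&& (r &&& q)) &&& c) = 0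
  four_blue : ∀ q r x c, [q, r, x, c].Sublist l → strip^[3] ((x &&& (r &&& q)) &&& c) = 0

/-- Once `x` counts as chosen, `three_blue` supplies `rows_blue`, `rows_three_blue` supplies
`pairs_blue`, and `four_blue` supplies `rows_three_blue`. -/
theorem Admissible.tail {E s x : ℕ} {rows pairs l : List ℕ}
    (h : Admissible E s rows pairs (x :: l)) :
    Admissible (columnNext E x) (s + maskDegree x 14) (x :: rows)
      (rows.map (Nat.land x) ++ pairs) l where
  columns := h.columns.2
  sum_le := by simpa [add_assoc] using h.sum_le
  sorted := h.sorted.of_cons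
  red y c hy := h.red y c (hy.cons x)
  rows_blue r hr y c hy := by
    rcases List.mem_cons.1 hr with rfl | hr
    · exact h.three_blue _ y c (hy.cons_cons _)
    · exact h.rows_blue r hr y c (hy.cons x)
  pairs_blue p hp y c hy := by
    rcases List.mem_append.1 hp with hp | hp
    · obtain ⟨q, hq, rfl⟩ := List.mem_map.1 hp
      exact h.rows_three_blue q hq x y c (hy.cons_cons x)
    · exact h.pairs_blue p hp y c (hy.cons x)
  three_blue r y c hy := h.three_blue r y c (hy.cons x)
  rows_three_blue q hq r y c hy := by
    rcases List.mem_cons.1 hq with rfl | hq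
    · exact h.four_blue _ r y c (hy.cons_cons _)
    · exact h.rows_three_blue q hq r y c (hy.cons x)
  four_blue q r y c hy := h.four_blue q r y c (hy.cons x)

theorem Admissible.degree_le {E s x : ℕ} {rows pairs l : List ℕ}
    (h : Admissible E s rows pairs (x :: l)) : s + maskDegree x 14 * (l.length + 1) ≤ 39 := by
  refine le_trans (Nat.add_le_add_left ?_ s) h.sum_le
  rw [List.map_cons, List.sum_cons]
  have : (l.map (maskDegree · 14)).length • maskDegree x 14 ≤
      (l.map (maskDegree · 14)).sum := by
    refine List.card_nsmul_le_sum _ _ fun d hd => ?_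
    obtain ⟨c, hc, rfl⟩ := List.mem_map.1 hd
    exact List.rel_of_pairwise_cons h.sorted hc
  rw [List.length_map, smul_eq_mul] at this
  rw [mul_add_one, mul_comm]
  omega

theorem Admissible.sublist_filter {E s x : ℕ} {rows pairs l rest : List ℕ}
    (h : Admissible E s rows pairs (x :: l)) (hl : l.Sublist rest) :
    l.Sublist (rest.filter (compat x (rows.map (Nat.land x)) (pairs.map (Nat.land x)))) := by
  have hall : ∀ c ∈ l, compat x (rows.map (Nat.land x)) (pairs.map (Nat.land x)) c = true := by
    intro c hc
    have hxc : [x, c].Sublist (x :: l) := (List.singleton_sublist.2 hc).cons_cons x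
    refine compat_eq_true (h.red x c hxc) (fun y hy => ?_) fun y hy => ?_
    · obtain ⟨r, hr, rfl⟩ := List.mem_map.1 hy
      exact h.rows_blue r hr x c hxc
    · obtain ⟨r, hr, rfl⟩ := List.mem_map.1 hy
      exact h.pairs_blue r hr x c hxc
  have := hl.filter (compat x (rows.map (Nat.land x)) (pairs.map (Nat.land x)))
  rwa [List.filter_eq_self.2 hall] at this

/-- The branch that picks the successive heads of `l` is never pruned, and it ends at depth zero,
where the search reports failure. -/
theorem search_eq_false {k E s : ℕ} {rows pairs cand l : List ℕ} (hk : l.length = k)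
    (hl : l.Sublist cand) (h : Admissible E s rows pairs l) :
    search k E s rows pairs cand = false := by
  induction k generalizing E s rows pairs cand l with
  | zero => rfl
  | succ k ih =>
    obtain ⟨x, l, rfl⟩ := List.exists_cons_of_length_eq_add_one hk
    rw [List.length_cons, add_left_inj] at hk
    by_contra hs
    rw [Bool.not_eq_false, search] at hs
    obtain ⟨rest, hrest, hstep⟩ := exists_of_scan hs hl
    have hdeg : Nat.ble (Nat.add s (Nat.mul (maskDegree x 14) k.succ)) 39 = true := by
      rw [Nat.ble_eq]
      exact hk ▸ h.degree_le
    have hsub := h.sublist_filter hrest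
    simp only [h.columns.1, hdeg, kernelFilter_eq, cond_true, Bool.or_eq_true] at hstep
    rcases hstep with hstep | hstep
    · have h1 := hsub.length_le
      have h2 := (Nat.blt_eq (x := _) (y := k)).mp hstep
      omega
    · have := ih hk hsub h.tail
      simp only [Nat.add_eq] at hstep
      rw [this] at hstep
      exact Bool.false_ne_true hstep

/-! ### The list of candidates -/

theorem maskDegree_two_pow_add {n k : ℕ} (b : ℕ) (hk : k ≤ n) :
    maskDegree (2 ^ n + b) k = maskDegree b k := by
  induction k with
  | zero => rfl
  | succ k ih =>
    rw [maskDegree, maskDegree, Nat.testBit_two_pow_add_gt (by omega), ih (by omega)]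

theorem maskDegree_two_pow_sub_one {n k : ℕ} (hk : k ≤ n) : maskDegree (2 ^ n - 1) k = 0 := by
  induction k with
  | zero => rfl
  | succ k ih =>
    rw [maskDegree, Nat.testBit_two_pow_sub_one, ih (by omega), decide_eq_true (by omega)]
    rfl

theorem maskDegree_succ_of_lt {n b : ℕ} (hb : b < 2 ^ n) :
    maskDegree b (n + 1) = maskDegree b n + 1 := by
  rw [maskDegree, Nat.testBit_lt_two_pow hb]
  rfl

theorem maskDegree_two_pow_add_self {n b : ℕ} (hb : b < 2 ^ n) :
    maskDegree (2 ^ n + b) (n + 1) = maskDegree b n := by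
  rw [maskDegree, Nat.testBit_two_pow_add_eq, Nat.testBit_lt_two_pow hb,
    maskDegree_two_pow_add b le_rfl]
  rfl

theorem masksOfDegree_zero (n : ℕ) : masksOfDegree n 0 = [2 ^ n - 1] := by
  cases n <;> rfl

theorem mem_masksOfDegree {n b : ℕ} (hb : b < 2 ^ n) : b ∈ masksOfDegree n (maskDegree b n) := by
  induction n generalizing b with
  | zero =>
    obtain rfl : b = 0 := by omega
    exact List.mem_singleton_self 0
  | succ n ih =>
    rcases Nat.lt_or_ge b (2 ^ n) with h | h
    · rw [maskDegree_succ_of_lt h, masksOfDegree]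
      exact List.mem_append_left _ (ih h)
    · obtain ⟨b, rfl⟩ := Nat.exists_eq_add_of_le h
      have hb' : b < 2 ^ n := by
        rw [pow_succ] at hb
        omega
      rw [maskDegree_two_pow_add_self hb']
      have := ih hb'
      cases hd : maskDegree b n with
      | zero =>
        rw [hd, masksOfDegree_zero, List.mem_singleton] at this
        rw [masksOfDegree_zero, List.mem_singleton, pow_succ]
        omega
      | succ d =>
        rw [hd] at this
        exact List.mem_append_right _ (List.mem_map.2 ⟨b, this, rfl⟩)

theorem of_mem_masksOfDegree {n d b : ℕ} (h : b ∈ masksOfDegree n d) :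
    b < 2 ^ n ∧ maskDegree b n = d := by
  induction n generalizing d b with
  | zero =>
    cases d with
    | zero =>
      obtain rfl := List.mem_singleton.1 h
      exact ⟨by norm_num, rfl⟩
    | succ d => exact absurd h List.not_mem_nil
  | succ n ih =>
    cases d with
    | zero =>
      rw [masksOfDegree_zero, List.mem_singleton] at h
      subst h
      exact ⟨Nat.sub_lt (by positivity) one_pos, maskDegree_two_pow_sub_one le_rfl⟩
    | succ d =>
      rcases List.mem_append.1 h with h | h
      · obtain ⟨h1, h2⟩ := ih h
        rw [maskDegree_succ_of_lt h1, h2, pow_succ]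
        omega
      · obtain ⟨b, hb, rfl⟩ := List.mem_map.1 h
        obtain ⟨h1, h2⟩ := ih hb
        change 2 ^ n + b < _ ∧ maskDegree (2 ^ n + b) _ = _
        rw [maskDegree_two_pow_add_self h1, h2, pow_succ]
        omega

theorem masksOfDegree_pairwise (n d : ℕ) : (masksOfDegree n d).Pairwise (· ≤ ·) := by
  induction n generalizing d with
  | zero => cases d <;> simp [masksOfDegree]
  | succ n ih =>
    cases d with
    | zero => simp [masksOfDegree]
    | succ d =>
      rw [masksOfDegree, List.pairwise_append]
      refine ⟨ih d, List.pairwise_map.2 ((ih _).imp fun h => Nat.add_le_add_left h _),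
        fun a ha b hb => ?_⟩
      obtain ⟨c, -, rfl⟩ := List.mem_map.1 hb
      have := (of_mem_masksOfDegree ha).1
      change a ≤ 2 ^ n + c
      omega

/-- Rows are sorted by degree first. -/
def maskKey (b : ℕ) : ℕ ×ₗ ℕ := toLex (maskDegree b 14, b)

theorem candidates_pairwise (d : ℕ) : (candidates d).Pairwise (maskKey · ≤ maskKey ·) := by
  rw [candidates, List.pairwise_flatMap]
  refine ⟨fun e _ => (masksOfDegree_pairwise 14 e).imp_of_mem fun {a b} ha hb hab => ?_, ?_⟩
  · rw [maskKey, maskKey, Prod.Lex.toLex_le_toLex]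
    exact Or.inr ⟨(of_mem_masksOfDegree ha).2.trans (of_mem_masksOfDegree hb).2.symm, hab⟩
  · refine List.Pairwise.imp (fun {e e'} hee a ha b hb => ?_) List.pairwise_lt_range'
    rw [maskKey, maskKey, Prod.Lex.toLex_le_toLex]
    left
    change maskDegree a 14 < maskDegree b 14
    rwa [(of_mem_masksOfDegree ha).2, (of_mem_masksOfDegree hb).2]

theorem maskDegree_le (b n : ℕ) : maskDegree b n ≤ n := by
  induction n with
  | zero => exact le_rfl
  | succ n ih =>
    rw [maskDegree]
    cases b.testBit n
    · exact Nat.succ_le_succ ih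
    · exact le_trans ih n.le_succ

theorem mem_candidates {d b : ℕ} (hb : b < 2 ^ 14) (hd : d ≤ maskDegree b 14) :
    b ∈ candidates d := by
  have := maskDegree_le b 14
  exact List.mem_flatMap.2 ⟨_, List.mem_range'_1.2 (by omega), mem_masksOfDegree hb⟩

/-- The key contains the mask itself. Antisymmetry is what makes a sorted list, contained in the
sorted candidates without repetition, a sublist of them. -/
instance : Std.Antisymm fun a b : ℕ => maskKey a ≤ maskKey b where
  antisymm _ _ hab hba := congrArg (fun x => (ofLex x).2) (le_antisymm hab hba)

theorem sublist_candidates {d : ℕ} {l : List ℕ} (hn : l.Nodup)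
    (hl : l.Pairwise (maskKey · ≤ maskKey ·)) (hlt : ∀ b ∈ l, b < 2 ^ 14)
    (hd : ∀ b ∈ l, d ≤ maskDegree b 14) : l.Sublist (candidates d) :=
  List.sublist_of_subperm_of_pairwise (r := fun a b => maskKey a ≤ maskKey b)
    (List.subperm_of_subset hn fun b hb => mem_candidates (hlt b hb) (hd b hb)) hl
    (candidates_pairwise d)

theorem not_admissible {l : List ℕ} (hlen : l.length = 9) (hn : l.Nodup)
    (hl : l.Pairwise (maskKey · ≤ maskKey ·)) (hlt : ∀ b ∈ l, b < 2 ^ 14)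
    (hd : ∀ b ∈ l, 2 ≤ maskDegree b 14) : ¬ Admissible 16382 0 [] [] l := by
  intro h
  obtain ⟨x, l, rfl⟩ := List.exists_cons_of_length_eq_add_one hlen
  rw [List.length_cons, add_left_inj] at hlen
  have hx := List.mem_cons_self (a := x) (l := l)
  have hsub : l.Sublist (candidates (maskDegree x 14)) :=
    sublist_candidates hn.of_cons hl.of_cons (fun b hb => hlt b (List.mem_cons_of_mem x hb))
      fun b hb => List.rel_of_pairwise_cons h.sorted hb
  have hfalse : searchFrom (maskDegree x 14) ≠ true := by
    rw [searchFrom, kernelAll_eq]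
    intro hall
    have hstep := List.all_eq_true.1 hall x (mem_masksOfDegree (hlt x hx))
    have hsearch := search_eq_false hlen (h.sublist_filter hsub) h.tail
    simp only [List.map_nil, List.append_nil, zero_add] at hsearch
    rw [h.columns.1, cond_true, kernelFilter_eq, hsearch] at hstep
    exact Bool.false_ne_true hstep
  have hdeg := h.degree_le
  rw [hlen] at hdeg
  have h2 := hd x hx
  -- Nine rows of degree at least 5 would exceed the total 39.
  obtain hx | hx | hx : maskDegree x 14 = 2 ∨ maskDegree x 14 = 3 ∨ maskDegree x 14 = 4 := by
    omega
  · exact hfalse (hx ▸ searchFrom_two)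
  · exact hfalse (hx ▸ searchFrom_three)
  · exact hfalse (hx ▸ searchFrom_four)

/-! ### Colourings as lists of masks -/

section

variable {m n : ℕ}

/-- The blue columns of a row, as a binary number. -/
def rowMask (R : Fin m → Fin n → Bool) (i : Fin m) : ℕ := Nat.ofBits fun j => !R i j

theorem testBit_rowMask {R : Fin m → Fin n → Bool} {i : Fin m} {j : ℕ} :
    (rowMask R i).testBit j = true ↔ ∃ h : j < n, R i ⟨j, h⟩ = false := by
  rw [rowMask, Nat.testBit_ofBits]
  split_ifs with h <;> simp [h]

theorem maskDegree_eq_sum (b k : ℕ) :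
    maskDegree b k = ∑ j : Fin k, if b.testBit j = true then 0 else 1 := by
  induction k with
  | zero => rfl
  | succ k ih =>
    rw [Fin.sum_univ_castSucc, maskDegree, ih]
    cases h : b.testBit k <;> simp [h]

theorem maskDegree_rowMask (R : Fin m → Fin n → Bool) (i : Fin m) :
    maskDegree (rowMask R i) n = rowDegree R i := by
  rw [maskDegree_eq_sum, rowDegree, card_filter]
  refine sum_congr rfl fun j _ => ?_
  cases h : R i j <;> simp [rowMask, h]

theorem rowDegree_comp_right (R : Fin m → Fin n → Bool) (τ : Equiv.Perm (Fin n)) (i : Fin m) :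
    rowDegree (fun i j => R i (τ j)) i = rowDegree R i := by
  rw [rowDegree, rowDegree, card_filter, card_filter]
  exact Equiv.sum_comp τ fun j => if R i j = true then 1 else 0

theorem rowMask_lt_of_swap {R : Fin m → Fin n → Bool} {i : Fin m} {j j' : Fin n}
    (hj : j < j') (hred : R i j = true) (hblue : R i j' = false) :
    rowMask (fun i k => R i (Equiv.swap j j' k)) i < rowMask R i := by
  refine Nat.lt_of_testBit j'.val ?_ ?_ fun k hk => ?_
  · simp [rowMask, hred]
  · simp [rowMask, hblue]
  · rw [rowMask, rowMask, Nat.testBit_ofBits, Nat.testBit_ofBits]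
    split_ifs with hkn
    · rw [Equiv.swap_apply_of_ne_of_ne]
      · exact fun h => by have := congrArg Fin.val h; simp at this; omega
      · exact fun h => by have := congrArg Fin.val h; simp at this; omega
    · rfl

/-- Rows and columns can be permuted so that rows are sorted and, in each block of columns which
agree in all earlier rows, red columns come last. -/
theorem exists_perm_sorted (R : Fin m → Fin 14 → Bool) :
    ∃ (σ : Equiv.Perm (Fin m)) (τ : Equiv.Perm (Fin 14)),
      (∀ i i', i ≤ i' → maskKey (rowMask (fun i j => R (σ i) (τ j)) i) ≤
        maskKey (rowMask (fun i j => R (σ i) (τ j)) i')) ∧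
      ∀ i (j j' : Fin 14), j < j' → (∀ i' < i, R (σ i') (τ j) = R (σ i') (τ j')) →
        R (σ i) (τ j') = false → R (σ i) (τ j) = false := by
  -- Minimise the sequence of row keys lexicographically over all permutations. Swapping two rows
  -- out of order would lower it; so would swapping an offending pair of columns, which fixes the
  -- earlier rows and keeps the degree of row `i` but lowers its mask.
  obtain ⟨⟨σ, τ⟩, hmin⟩ := Finite.exists_min
    fun p : Equiv.Perm (Fin m) × Equiv.Perm (Fin 14) =>
      toLex fun i => maskKey (rowMask (fun i j => R (p.1 i) (p.2 j)) i)
  refine ⟨σ, τ, fun i i' hi => ?_, fun i j j' hj heq hblue => ?_⟩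
  · by_contra! hlt
    have hdesc := Pi.lex_desc (f := fun i => maskKey (rowMask (fun i j => R (σ i) (τ j)) i)) hi hlt
    exact not_lt_of_ge (hmin ((Equiv.swap i i').trans σ, τ)) hdesc
  · by_contra hred
    rw [Bool.not_eq_false] at hred
    refine not_lt_of_ge (hmin (σ, (Equiv.swap j j').trans τ)) ⟨i, fun i' hi' => ?_, ?_⟩
    · change maskKey (Nat.ofBits fun k => !R (σ i') (τ (Equiv.swap j j' k))) =
        maskKey (Nat.ofBits fun k => !R (σ i') (τ k))
      congr 2
      funext k
      rcases eq_or_ne k j with rfl | hkj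
      · rw [Equiv.swap_apply_left, heq i' hi']
      rcases eq_or_ne k j' with rfl | hkj'
      · rw [Equiv.swap_apply_right, heq i' hi']
      rw [Equiv.swap_apply_of_ne_of_ne hkj hkj']
    · change maskKey (rowMask (fun i k => R (σ i) (τ (Equiv.swap j j' k))) i) <
        maskKey (rowMask (fun i k => R (σ i) (τ k)) i)
      rw [maskKey, maskKey, Prod.Lex.toLex_lt_toLex]
      have hdeg : maskDegree (rowMask (fun i k => R (σ i) (τ (Equiv.swap j j' k))) i) 14 =
          maskDegree (rowMask (fun i k => R (σ i) (τ k)) i) 14 := by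
        rw [maskDegree_rowMask, maskDegree_rowMask]
        exact rowDegree_comp_right (fun i j => R (σ i) (τ j)) (Equiv.swap j j') i
      have hlt : rowMask (fun i k => R (σ i) (τ (Equiv.swap j j' k))) i <
          rowMask (fun i k => R (σ i) (τ k)) i :=
        rowMask_lt_of_swap (R := fun i k => R (σ i) (τ k)) hj hred hblue
      exact Or.inr ⟨hdeg, hlt⟩

theorem IsAvoiding.comp_perm {R : Fin m → Fin n → Bool} (hR : IsAvoiding R)
    (σ : Equiv.Perm (Fin m)) (τ : Equiv.Perm (Fin n)) :
    IsAvoiding fun i j => R (σ i) (τ j) := by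
  refine ⟨fun S hS => ?_, fun S hS => ?_⟩
  · refine le_trans ?_ (hR.red (S.map σ.toEmbedding) (by simpa using hS))
    refine card_le_card_of_injOn τ (fun j hj => ?_) τ.injective.injOn
    simp only [coe_filter, mem_univ, true_and, Set.mem_ofPred_eq, forall_mem_map] at hj ⊢
    exact hj
  · refine le_trans ?_ (hR.blue (S.map σ.toEmbedding) (by simpa using hS))
    refine card_le_card_of_injOn τ (fun j hj => ?_) τ.injective.injOn
    simp only [coe_filter, mem_univ, true_and, Set.mem_ofPred_eq, forall_mem_map] at hj ⊢
    exact hj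

theorem strip_iterate_eq_zero {k y : ℕ} (T : Finset ℕ) (hT : ∀ j, y.testBit j = true → j ∈ T)
    (hk : #T ≤ k) : strip^[k] y = 0 := by
  induction k generalizing y T with
  | zero =>
    obtain rfl : T = ∅ := by simpa using hk
    exact Nat.zero_of_testBit_eq_false fun j => by
      by_contra h
      exact absurd (hT j (by simpa using h)) (notMem_empty j)
  | succ k ih =>
    rw [Function.iterate_succ_apply]
    have hbit : ∀ j, (strip y).testBit j = (y.testBit j && (y - 1).testBit j) :=
      fun j => Nat.testBit_land y (y - 1) j
    rcases Nat.eq_zero_or_pos y with rfl | hy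
    · exact ih ∅ (fun j hj => by simp [hbit] at hj) (by simp)
    -- It suffices that `strip` loses some bit of `y` and adds none; which bit is lost does not
    -- matter.
    · have hne : strip y ≠ y := by
        have : strip y ≤ y - 1 := Nat.and_le_right
        omega
      obtain ⟨j, hj⟩ := Nat.exists_testBit_ne_of_ne hne
      have hyj : y.testBit j = true ∧ (strip y).testBit j = false := by
        rw [hbit] at hj ⊢
        cases h : y.testBit j <;> simp [h] at hj ⊢
        exact hj
      refine ih (T.erase j) (fun i hi => ?_) ?_
      · refine mem_erase.2 ⟨?_, hT i ?_⟩
        · rintro rfl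
          rw [hyj.2] at hi
          exact Bool.false_ne_true hi
        · rw [hbit, Bool.and_eq_true] at hi
          exact hi.1
      · rw [card_erase_of_mem (hT j hyj.1)]
        omega

theorem exists_nodup_map_of_sublist_ofFn {α : Type*} {f : Fin m → α} {l : List α}
    (h : l.Sublist (List.ofFn f)) : ∃ l' : List (Fin m), l'.Nodup ∧ l = l'.map f := by
  rw [List.ofFn_eq_map, List.sublist_map_iff] at h
  obtain ⟨l', hl', rfl⟩ := h
  exact ⟨l', (List.nodup_finRange m).sublist hl', rfl⟩

theorem strip_iterate_eq_zero_of_blue {R : Fin m → Fin n → Bool} {s k y : ℕ}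
    (h : ∀ S : Finset (Fin m), #S = s → #{j | ∀ i ∈ S, R i j = false} ≤ k) {S : Finset (Fin m)}
    (hS : #S = s) (hs : 0 < s)
    (hy : ∀ j, y.testBit j = true → ∀ i ∈ S, (rowMask R i).testBit j = true) :
    strip^[k] y = 0 := by
  refine strip_iterate_eq_zero (({j | ∀ i ∈ S, R i j = false} : Finset (Fin n)).map
    Fin.valEmbedding) (fun j hj => ?_) (by rw [card_map]; exact h S hS)
  obtain ⟨i, hi⟩ := card_pos.1 (hS ▸ hs)
  obtain ⟨hjn, -⟩ := testBit_rowMask.1 (hy j hj i hi)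
  exact mem_map.2 ⟨⟨j, hjn⟩, mem_filter.2 ⟨mem_univ _, fun i hi =>
    (testBit_rowMask.1 (hy j hj i hi)).2⟩, rfl⟩

/-- The list `p` holds the rows already read; it grows along the induction, so that the marks in `E`
always mean agreement on `p`. -/
theorem columnSorted_of_forall {E : ℕ} {p l : List ℕ}
    (hE : ∀ j, E.testBit j = true →
      ∃ k < 13, j = k + 1 ∧ ∀ y ∈ p, y.testBit k = y.testBit (k + 1))
    (h : ∀ q x r, p ++ l = q ++ x :: r → ∀ k < 13,
      (∀ y ∈ q, y.testBit k = y.testBit (k + 1)) → x.testBit (k + 1) = true →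
        x.testBit k = true) : ColumnSorted E l := by
  induction l generalizing E p with
  | nil => trivial
  | cons x l ih =>
    have hshift : ∀ k, (x <<< 1).testBit (k + 1) = x.testBit k := fun k => by
      simp [Nat.testBit_shiftLeft]
    refine ⟨?_, ih (p := p ++ [x]) (fun j hj => ?_) fun q y r hq => h q y r (by simpa using hq)⟩
    · rw [columnTest, Nat.beq_eq]
      change (x &&& E) &&& (x <<< 1) = x &&& E
      refine Nat.eq_of_testBit_eq fun j => ?_
      rw [Nat.testBit_and _ (x <<< 1), Nat.testBit_and]
      cases hx : x.testBit j <;> cases hEj : E.testBit j <;> simp only [Bool.and_false,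
        Bool.false_and, Bool.and_true]
      obtain ⟨k, hk, rfl, hp⟩ := hE j hEj
      rw [hshift]
      exact h p x l rfl k hk hp hx
    · change (E ^^^ (E &&& (x ^^^ (x <<< 1)))).testBit j = true at hj
      rw [Nat.testBit_xor, Nat.testBit_and, Nat.testBit_xor] at hj
      have hEj : E.testBit j = true := by
        cases hEj : E.testBit j
        · simp [hEj] at hj
        · rfl
      obtain ⟨k, hk, rfl, hp⟩ := hE j hEj
      refine ⟨k, hk, rfl, fun y hy => ?_⟩
      rcases List.mem_append.1 hy with hy | hy
      · exact hp y hy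
      · obtain rfl := List.mem_singleton.1 hy
        rw [hEj, hshift] at hj
        cases h1 : y.testBit k <;> cases h2 : y.testBit (k + 1) <;> simp [h1, h2] at hj ⊢

end

/-! ### The upper bound for nine rows -/

theorem arrows_nine : BipartiteArrows 9 14 (Ktt 2) (Ktt 4) := by
  rw [bipartiteArrows_iff]
  intro R₀ hR₀
  obtain ⟨σ, τ, hrow, hcol⟩ := exists_perm_sorted R₀
  have hR := hR₀.comp_perm σ τ
  set R : Fin 9 → Fin 14 → Bool := fun i j => R₀ (σ i) (τ j) with hRdef
  have h3 := hR.card_blue_lt (w := 6) hR.blue (by decide)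
  have h2 := hR.card_blue_lt (w := 9) (fun S hS => Nat.lt_succ_iff.1 (h3 S hS)) (by decide)
  have h1 := hR.card_blue_lt (w := 13) (fun S hS => Nat.lt_succ_iff.1 (h2 S hS)) (by decide)
  have hdeg : ∀ i, 2 ≤ rowDegree R i := fun i => by
    have := h1 {i} rfl
    have := rowDegree_add_card_blue (R := R) i
    omega
  have hlt : ∀ i, rowMask R i < 2 ^ 14 := fun i => Nat.ofBits_lt_two_pow _
  have hred : ∀ i i', i ≠ i' → strip (16383 - (rowMask R i ||| rowMask R i')) = 0 := by
    intro i i' hii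
    refine strip_iterate_eq_zero (k := 1)
      (({j | ∀ k ∈ ({i, i'} : Finset (Fin 9)), R k j = true} : Finset (Fin 14)).map
        Fin.valEmbedding) (fun j hj => ?_) (by
        rw [card_map]; exact hR.red _ (card_pair hii))
    have hor := Nat.or_lt_two_pow (hlt i) (hlt i')
    have h16 : 16383 - (rowMask R i ||| rowMask R i') =
        2 ^ 14 - ((rowMask R i ||| rowMask R i') + 1) := by omega
    rw [h16, Nat.testBit_two_pow_sub_succ hor, Bool.and_eq_true, decide_eq_true_eq,
      Nat.testBit_or, Bool.not_eq_true', Bool.or_eq_false_iff] at hj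
    obtain ⟨hj14, hji, hji'⟩ := hj
    refine mem_map.2 ⟨⟨j, hj14⟩, mem_filter.2 ⟨mem_univ _, ?_⟩, rfl⟩
    have hR' : ∀ k, (rowMask R k).testBit j = false → R k ⟨j, hj14⟩ = true := by
      intro k hk
      rw [rowMask, Nat.testBit_ofBits_lt _ _ hj14] at hk
      simpa using hk
    simp only [mem_insert, mem_singleton, forall_eq_or_imp, forall_eq]
    exact ⟨hR' i hji, hR' i' hji'⟩
  -- Equal rows would share all their red columns, of which there are at least two.
  have hinj : Function.Injective (rowMask R) := by
    intro i i' hii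
    by_contra hne
    have hsub : ({j | R i j = true} : Finset (Fin 14)) ⊆
        ({j | ∀ k ∈ ({i, i'} : Finset (Fin 9)), R k j = true} : Finset (Fin 14)) := by
      intro j hj
      simp only [mem_filter, mem_univ, true_and, mem_insert, mem_singleton, forall_eq_or_imp,
        forall_eq] at hj ⊢
      refine ⟨hj, ?_⟩
      have := congrArg (fun b => Nat.testBit b j) hii
      simpa [rowMask, hj] using this
    have := card_le_card hsub
    have := hR.red _ (card_pair hne)
    have := hdeg i
    rw [rowDegree] at this
    omega
  have hadm : Admissible 16382 0 [] [] (List.ofFn (rowMask R)) := by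
    refine ⟨?_, ?_, ?_, ?_, by simp, by simp, ?_, by simp, ?_⟩
    · refine columnSorted_of_forall (p := []) (fun j hj => ?_) fun q x r hq k hk hy hx => ?_
      · have hj14 : j < 14 := by
          by_contra! hge
          rw [Nat.testBit_lt_two_pow (lt_of_lt_of_le (by norm_num)
            (Nat.pow_le_pow_right two_pos hge))] at hj
          exact Bool.false_ne_true hj
        rcases j with _ | k
        · simp at hj
        · exact ⟨k, by omega, rfl, by simp⟩
      · rw [List.nil_append] at hq
        have hlen : q.length < 9 := by
          have := congrArg List.length hq
          simp at this
          omega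
        have hget : ∀ i (hi : i < 9), (q ++ x :: r)[i]? = some (rowMask R ⟨i, hi⟩) := by
          intro i hi
          rw [← hq, List.getElem?_ofFn, dif_pos hi]
        have hxi : x = rowMask R ⟨q.length, hlen⟩ := by
          have := hget _ hlen
          simpa using this
        have hk14 : k < 14 := by omega
        have hk14' : k + 1 < 14 := by omega
        rw [hxi] at hx ⊢
        obtain ⟨_, hblue⟩ := testBit_rowMask.1 hx
        refine testBit_rowMask.2 ⟨hk14, hcol ⟨q.length, hlen⟩ ⟨k, hk14⟩ ⟨k + 1, hk14'⟩
          (Nat.lt_succ_self k) (fun i hi => ?_) hblue⟩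
        have hiq : i.val < q.length := hi
        have hmem : rowMask R i ∈ q := by
          have := hget i.val i.isLt
          rw [List.getElem?_append_left hiq] at this
          exact List.mem_of_getElem? this
        have := hy _ hmem
        rw [rowMask, Nat.testBit_ofBits_lt _ _ hk14, Nat.testBit_ofBits_lt _ _ hk14'] at this
        simpa [hRdef] using this
    -- Here `(36 + 3 * 14) / 2 = 39`.
    · have := hR.two_mul_sum_rowDegree_le
      rw [List.map_ofFn, List.sum_ofFn, zero_add]
      simp only [Function.comp_apply, maskDegree_rowMask]
      simp only [Nat.choose] at this
      omega
    · rw [List.pairwise_ofFn]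
      intro i i' hi
      have := hrow i i' hi.le
      rw [maskKey, maskKey, Prod.Lex.toLex_le_toLex] at this
      rcases this with h | h
      · exact le_of_lt h
      · exact le_of_eq h.1
    · intro x c hxc
      obtain ⟨l, hl, hmap⟩ := exists_nodup_map_of_sublist_ofFn hxc
      match l, hl, hmap with
      | [i, i'], hl, hmap =>
        simp only [List.map_cons, List.map_nil, List.cons.injEq, and_true] at hmap
        obtain ⟨rfl, rfl⟩ := hmap
        exact hred i i' (by simpa using hl)
    · intro r x c hxc
      obtain ⟨l, hl, hmap⟩ := exists_nodup_map_of_sublist_ofFn hxc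
      refine strip_iterate_eq_zero_of_blue (fun S hS => Nat.lt_succ_iff.1 (h3 S hS))
        (S := l.toFinset) ?_ three_pos fun j hj i hi => ?_
      · rw [List.toFinset_card_of_nodup hl, ← List.length_map (rowMask R), ← hmap]
        rfl
      · have : rowMask R i ∈ [r, x, c] := by
          rw [hmap]
          exact List.mem_map_of_mem (List.mem_toFinset.1 hi)
        simp only [Nat.testBit_and, Bool.and_eq_true] at hj
        simp only [List.mem_cons, List.not_mem_nil, or_false] at this
        rcases this with h | h | h <;> rw [h] <;> tauto
    · intro q r x c hxc
      obtain ⟨l, hl, hmap⟩ := exists_nodup_map_of_sublist_ofFn hxc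
      refine strip_iterate_eq_zero_of_blue hR.blue
        (S := l.toFinset) ?_ four_pos fun j hj i hi => ?_
      · rw [List.toFinset_card_of_nodup hl, ← List.length_map (rowMask R), ← hmap]
        rfl
      · have : rowMask R i ∈ [q, r, x, c] := by
          rw [hmap]
          exact List.mem_map_of_mem (List.mem_toFinset.1 hi)
        simp only [Nat.testBit_and, Bool.and_eq_true] at hj
        simp only [List.mem_cons, List.not_mem_nil, or_false] at this
        rcases this with h | h | h | h <;> rw [h] <;> tauto
  refine not_admissible List.length_ofFn (List.nodup_ofFn.2 hinj) ?_ ?_ ?_ hadm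
  · rw [List.pairwise_ofFn]
    exact fun i i' hi => hrow i i' hi.le
  · intro b hb
    obtain ⟨i, rfl⟩ := List.mem_ofFn.1 hb
    exact hlt i
  · intro b hb
    obtain ⟨i, rfl⟩ := List.mem_ofFn.1 hb
    rw [maskDegree_rowMask]
    exact hdeg i

theorem theorem1 (m : ℕ) (hm : 2 ≤ m) :
    ((m = 2 ∨ m = 3 ∨ m = 4) → ¬ ∃ n : ℕ, IsBipartiteRamsey m (Ktt 2) (Ktt 4) n) ∧
    (m = 5 → IsBipartiteRamsey m (Ktt 2) (Ktt 4) 26) ∧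
    ((m = 6 ∨ m = 7) → IsBipartiteRamsey m (Ktt 2) (Ktt 4) 22) ∧
    (m = 8 → IsBipartiteRamsey m (Ktt 2) (Ktt 4) 16) ∧
    ((9 ≤ m ∧ m ≤ 13) → IsBipartiteRamsey m (Ktt 2) (Ktt 4) 14) := by
  refine ⟨fun h => ?_, fun h => ?_, fun h => ?_, fun h => ?_, fun h => ?_⟩
  · rintro ⟨n, hn⟩
    exact bipartiteArrows_iff.1 hn.1.2 _ (isAvoiding_row m n (by omega))
  · exact isBipartiteRamsey_of_avoiding arrows_five (by omega) isAvoiding_five (by omega)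
  · exact isBipartiteRamsey_of_avoiding arrows_six (by omega) isAvoiding_seven (by omega)
  · exact isBipartiteRamsey_of_avoiding arrows_eight (by omega) isAvoiding_eight (by omega)
  · exact isBipartiteRamsey_of_avoiding arrows_nine (by omega) isAvoiding_thirteen (by omega)
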